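/- Let $k\ge 1$ be an integer and let $s_0\in(0,2^{-1+1/k})$. There is a constant $c>0$, depending only on $k$ and $s_0$, such that for every integer $\ell\ge 0$ there is a constant $C>0$, depending only on $k$, $s_0$ and $\ell$, with the following property. Let $(X,d)$ be a countable metric space (the value $d(x,y)=\infty$ being allowed) and let $\pi$ be a positive measure on $X$ with $0<\pi(x)<\infty$ for every $x\in X$, where $\pi(x)=\pi(\{x\})$. For a bounded operator $T$ on the complex Hilbert space $\ell^2(X,\pi)$ let $T(x,y)=(T\delta_y)(x)$ be its matrix, so that $Tf(x)=\sum_y T(x,y)f(y)$. Let $M$ be a normal contraction on $\ell^2(X,\pi)$ such that $M(x,y)=0$ whenever $d(x,y)>1$, and such that the spectrum of $M$ is contained in $[a,1]$ for some $a\in[-1,1)$ with $1-a\le 2s_0$. Put $M_k=I-(I-M)^k$. Then, for all integers $n\ge 1$ and all $x,y\in X$, $$ |[(I-M)^\ell M_k^n](y,x)|\le C^{\ell}\left(\frac{\pi(x)}{\pi(y)}\right)^{1/2}(1+n)^{-\ell/k}\exp\left(-c\left(\frac{d(x,y)}{n^{1/(2k)}}\right)^{\frac{2k}{2k-1}}\right).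 $$ Further, for all $x\in X$ and all $0\le r,R\le\infty$, if $A_x(r,R)=\{y\in X: r<d(x,y)\le R\}$, then the following sum converges and $$ \left(\sum_{y\in A_x(r,R)}|[(I-M)^\ell M_k^n](y,x)|^2\,\pi(y)\right)^{1/2}\le C^{\ell}\,\pi(x)^{1/2}(1+n)^{-\ell/k}\exp\left(-c\left(\frac{r}{n^{1/(2k)}}\right)^{\frac{2k}{2k-1}}\right). $$ Here $\exp(-c\cdot\infty)=0$. -/

import Mathlib

open MeasureTheory
open scoped ENNReal

noncomputable section

/-- The function `δ_y`, equal to `1` at `y` and to `0` elsewhere, as an element of `ℓ²(X, π)`. -/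
def pointMass {X : Type*} [MeasurableSpace X] [MeasurableSingletonClass X] (π : Measure X)
    (hfin : ∀ x, π {x} ≠ ∞) (y : X) : Lp ℂ 2 π :=
  indicatorConstLp 2 (measurableSet_singleton y) (hfin y) 1

/-- The matrix coefficient `T(x, y) = (T δ_y)(x)` of a bounded operator `T` on `ℓ²(X, π)`, so that
`T f (x) = ∑_y T(x, y) f(y)`. It is used only for measures that charge every point of `X`, for which
an element of `ℓ²(X, π)` is a genuine function on `X`. -/
def kernel {X : Type*} [MeasurableSpace X] [MeasurableSingletonClass X] (π : Measure X)
    (hfin : ∀ x, π {x} ≠ ∞) (T : Lp ℂ 2 π →L[ℂ] Lp ℂ 2 π) (x y : X) : ℂ :=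
  (T (pointMass π hfin y) : X → ℂ) x

/-- The operator `M_k = I - (I - M)^k`. -/
def powerLaplacianOp {X : Type*} [MeasurableSpace X] {π : Measure X}
    (M : Lp ℂ 2 π →L[ℂ] Lp ℂ 2 π) (k : ℕ) : Lp ℂ 2 π →L[ℂ] Lp ℂ 2 π :=
  1 - (1 - M) ^ k

/-- The factor `exp (-c (r / n^{1/(2k)})^{2k/(2k-1)})`, with value `0` at `r = ∞`. -/
def offDiagonalDecay (k n : ℕ) (c : ℝ) (r : ℝ≥0∞) : ℝ :=
  if r = ∞ then 0
  else Real.exp (-c *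
    (r.toReal / (n : ℝ) ^ (1 / (2 * (k : ℝ)))) ^ (2 * (k : ℝ) / (2 * (k : ℝ) - 1)))

/-- The annulus `A_x(r, R) = {y : r < d(x, y) ≤ R}`. -/
def annulus {X : Type*} [EMetricSpace X] (x : X) (r R : ℝ≥0∞) : Set X :=
  {y | r < edist x y ∧ edist x y ≤ R}

end

/-! The operator is `F(M)` for a polynomial `F`, and a polynomial in `M` of degree at most `m` has
zero matrix coefficients at distance greater than `m`. Hence at such distances `F(M)` may be
replaced by `(F - P)(M)` for any `P` of degree at most `m`. Since `M` is normal, the norm of `(F -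
P)(M)` is at most the supremum of `|F - P|` on the spectrum, and both estimates follow by applying
this operator to a point mass. Everything reduces to approximating `u ^ ℓ (1 - u ^ k) ^ n`, `u = 1 -
t`, by polynomials on `0 ≤ u ≤ b = 2 s₀`.

Write `u = b (1 - cos w) / 2`. A bound for `F` on the line `Im w = η` makes the `J`-th Chebyshev
coefficient `O(exp (-J η))`, so truncation at degree `m` costs about `exp (-m η)`
(`exists_polynomial_approx`). Since `b ^ k < 2` and `u` has a double zero at `w = 0`, one has `|1 -
u ^ k| ≤ exp (-c |θ| ^ (2k) + C η ^ (2k))` at `w = θ + i η` (`exists_norm_one_sub_pow_le`). With `σ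
= n ^ (1 / (2k))` the error is then about `σ ^ (-2ℓ) exp (A (σ η) ^ (2k) - r η)`; choosing `(σ η) ^
(2k - 1)` proportional to `r / σ` gives the exponent `2k / (2k - 1)`, and `σ ^ (-2ℓ) = n ^ (-ℓ /
k)`.

For `ℓ = 0` the factor `C ^ ℓ` is `1` and absorbs no constant. There a constant polynomial already
has error at most some `q < 1`, and the rate is lowered to interpolate between the two bounds
(`exists_min_le_exp`). -/

section OperatorKernel

/-! ### Matrix coefficients and finite propagation. -/

open scoped InnerProductSpace

variable {X : Type*} [MeasurableSpace X] [MeasurableSingletonClass X] {π : Measure X}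

omit [MeasurableSingletonClass X] in
lemma ae_eq_at_point {f g : X → ℂ} (hpos : ∀ x, π {x} ≠ 0) (h : f =ᵐ[π] g) (x : X) :
    f x = g x := by
  by_contra hx
  refine hpos x (measure_mono_null ?_ (ae_iff.1 h))
  rintro y rfl
  exact hx

lemma inner_pointMass (hfin : ∀ x, π {x} ≠ ∞) (y : X) (f : Lp ℂ 2 π) :
    ⟪pointMass π hfin y, f⟫_ℂ = π.real {y} * f y := by
  rw [pointMass, L2.inner_indicatorConstLp_one, integral_singleton]
  simp

lemma norm_pointMass_sq (hfin : ∀ x, π {x} ≠ ∞) (y : X) :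
    ‖pointMass π hfin y‖ ^ 2 = π.real {y} := by
  rw [pointMass, norm_indicatorConstLp (by norm_num) (by norm_num)]
  rw [norm_one, one_mul, ← Real.rpow_natCast, ← Real.rpow_mul measureReal_nonneg]
  norm_num

omit [MeasurableSingletonClass X] in
lemma real_singleton_pos (hpos : ∀ x, π {x} ≠ 0) (hfin : ∀ x, π {x} ≠ ∞) (x : X) :
    0 < π.real {x} := ENNReal.toReal_pos (hpos x) (hfin x)

lemma hasSum_integral_of_countable [Countable X] {g : X → ℝ} (hg : Integrable g π) :
    HasSum (fun y => g y * π.real {y}) (∫ y, g y ∂π) := by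
  have hsum := hg
  rw [← Measure.sum_smul_dirac π] at hsum
  have h := hasSum_integral_measure hsum
  rw [Measure.sum_smul_dirac] at h
  have h1 : ∀ y, ∫ x, g x ∂(π {y} • Measure.dirac y) = g y * π.real {y} := fun y => by
    rw [integral_smul_measure, integral_dirac, measureReal_def, smul_eq_mul, mul_comm]
  simp_rw [h1] at h
  exact h

/-- The square norm on `ℓ²(X, π)` is the sum of the square moduli. -/
lemma hasSum_normSq_lp [Countable X] (f : Lp ℂ 2 π) :
    HasSum (fun y => ‖f y‖ ^ 2 * π.real {y}) (‖f‖ ^ 2) := by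
  have hint : Integrable (fun y => ‖f y‖ ^ 2) π := (Lp.memLp f).integrable_norm_pow (by norm_num)
  have h2 : ‖f‖ ^ 2 = ∫ y, ‖f y‖ ^ 2 ∂π := by
    have h := L2.inner_def (𝕜 := ℂ) f f
    rw [inner_self_eq_norm_sq_to_K] at h
    have h3 : ∀ y, ⟪f y, f y⟫_ℂ = ((‖f y‖ ^ 2 : ℝ) : ℂ) := fun y => by
      rw [inner_self_eq_norm_sq_to_K]; norm_cast
    simp_rw [h3] at h
    rw [integral_complex_ofReal] at h
    apply Complex.ofReal_injective
    rw [← h]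
    simp
  rw [h2]
  exact hasSum_integral_of_countable hint

lemma hasSum_kernel_sq [Countable X] (hfin : ∀ x, π {x} ≠ ∞)
    (T : Lp ℂ 2 π →L[ℂ] Lp ℂ 2 π) (x : X) :
    HasSum (fun y => ‖kernel π hfin T y x‖ ^ 2 * π.real {y}) (‖T (pointMass π hfin x)‖ ^ 2) :=
  hasSum_normSq_lp _

lemma norm_apply_pointMass_sq_le (hfin : ∀ x, π {x} ≠ ∞)
    (T : Lp ℂ 2 π →L[ℂ] Lp ℂ 2 π) (x : X) {B : ℝ} (hT : ‖T‖ ≤ B) :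
    ‖T (pointMass π hfin x)‖ ^ 2 ≤ B ^ 2 * π.real {x} := by
  rw [← norm_pointMass_sq hfin, ← mul_pow]
  gcongr
  exact T.le_of_opNorm_le hT _

/-- A bound for the norm of an operator bounds its matrix coefficients. -/
lemma norm_kernel_le [Countable X] (hpos : ∀ x, π {x} ≠ 0) (hfin : ∀ x, π {x} ≠ ∞)
    (T : Lp ℂ 2 π →L[ℂ] Lp ℂ 2 π) (x y : X) {B : ℝ} (hT : ‖T‖ ≤ B) :
    ‖kernel π hfin T y x‖ ≤ B * √(π.real {x} / π.real {y}) := by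
  have hy := real_singleton_pos hpos hfin y
  have h1 := (le_hasSum (hasSum_kernel_sq hfin T x) y fun _ _ => by positivity).trans
    (norm_apply_pointMass_sq_le hfin T x hT)
  have hB : 0 ≤ B := (norm_nonneg _).trans hT
  refine le_of_sq_le_sq ?_ (by positivity)
  rw [mul_pow, Real.sq_sqrt (by positivity), ← mul_div_assoc, le_div_iff₀ hy]
  exact h1

lemma kernel_sub (hpos : ∀ x, π {x} ≠ 0) (hfin : ∀ x, π {x} ≠ ∞)
    (S T : Lp ℂ 2 π →L[ℂ] Lp ℂ 2 π) (x y : X) :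
    kernel π hfin (S - T) y x = kernel π hfin S y x - kernel π hfin T y x := by
  unfold kernel
  rw [sub_apply]
  exact ae_eq_at_point hpos (Lp.coeFn_sub _ _) y

/-- Each application of `M` spreads supports by at most distance `1`. -/
lemma kernel_pow_eq_zero {X : Type*} [EMetricSpace X] [MeasurableSpace X]
    [MeasurableSingletonClass X] {π : Measure X}
    (hpos : ∀ x, π {x} ≠ 0) (hfin : ∀ x, π {x} ≠ ∞) {M : Lp ℂ 2 π →L[ℂ] Lp ℂ 2 π}
    (hM : ∀ x y, 1 < edist x y → kernel π hfin M x y = 0) (m : ℕ) (x y : X)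
    (h : (m : ℝ≥0∞) < edist x y) : kernel π hfin (M ^ m) y x = 0 := by
  induction m generalizing y with
  | zero =>
    have hne : y ≠ x := by rintro rfl; simp at h
    have h1 : (pointMass π hfin x : X → ℂ) y = _ :=
      ae_eq_at_point hpos indicatorConstLp_coeFn y
    simpa [kernel, hne] using h1
  | succ m ih =>
    set g := (M ^ m) (pointMass π hfin x) with hg
    -- Moving `M` onto the point mass avoids expanding `M g` as a series: `g` vanishes beyond
    -- distance `m` from `x`, the adjoint applied to `δ_y` vanishes beyond distance `1` from `y`,
    -- and these supports are disjoint.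
    have h1 : ⟪pointMass π hfin y, M g⟫_ℂ = 0 := by
      rw [← ContinuousLinearMap.adjoint_inner_left, L2.inner_def]
      refine integral_eq_zero_of_ae (Filter.Eventually.of_forall fun z => ?_)
      by_cases hz : (m : ℝ≥0∞) < edist x z
      · have : g z = 0 := ih z hz
        simp [this]
      · have hyz : 1 < edist y z := by
          by_contra! hc
          refine absurd h (not_lt.2 ?_)
          push_cast
          calc edist x y ≤ edist x z + edist z y := edist_triangle _ _ _
            _ ≤ m + 1 := add_le_add (not_lt.1 hz) (by rwa [edist_comm])
        have h2 : ⟪pointMass π hfin z, M.adjoint (pointMass π hfin y)⟫_ℂ = 0 := by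
          rw [ContinuousLinearMap.adjoint_inner_right, ← inner_conj_symm, inner_pointMass]
          have := hM y z hyz
          rw [kernel] at this
          simp [this]
        rw [inner_pointMass] at h2
        have hne : (π.real {z} : ℂ) ≠ 0 := by
          exact_mod_cast (real_singleton_pos hpos hfin z).ne'
        simp [(mul_eq_zero.1 h2).resolve_left hne]
    rw [inner_pointMass] at h1
    have hne : (π.real {y} : ℂ) ≠ 0 := by
      exact_mod_cast (real_singleton_pos hpos hfin y).ne'
    have h3 := (mul_eq_zero.1 h1).resolve_left hne
    rw [kernel, pow_succ']
    exact h3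

open Polynomial in
/-- A polynomial of degree at most `m` in an operator of propagation `1` has propagation `m`. -/
lemma kernel_aeval_eq_zero {X : Type*} [EMetricSpace X] [MeasurableSpace X]
    [MeasurableSingletonClass X] {π : Measure X}
    (hpos : ∀ x, π {x} ≠ 0) (hfin : ∀ x, π {x} ≠ ∞) {M : Lp ℂ 2 π →L[ℂ] Lp ℂ 2 π}
    (hM : ∀ x y, 1 < edist x y → kernel π hfin M x y = 0) (p : ℂ[X]) (x y : X)
    (h : (p.natDegree : ℝ≥0∞) < edist x y) : kernel π hfin (aeval M p) y x = 0 := by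
  have h1 : ⟪pointMass π hfin y, aeval M p (pointMass π hfin x)⟫_ℂ = 0 := by
    rw [aeval_eq_sum_range, sum_apply, inner_sum]
    refine Finset.sum_eq_zero fun i hi => ?_
    rw [smul_apply, inner_smul_right, inner_pointMass]
    have hi' : (i : ℝ≥0∞) ≤ p.natDegree := by
      exact_mod_cast Nat.lt_succ_iff.1 (Finset.mem_range.1 hi)
    have := kernel_pow_eq_zero hpos hfin hM i x y (hi'.trans_lt h)
    rw [kernel] at this
    rw [this, mul_zero, mul_zero]
  rw [inner_pointMass] at h1
  have hne : (π.real {y} : ℂ) ≠ 0 := by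
    exact_mod_cast (real_singleton_pos hpos hfin y).ne'
  exact (mul_eq_zero.1 h1).resolve_left hne

open Polynomial in
/-- The norm of a polynomial in a normal operator is bounded by its supremum on the spectrum. -/
lemma norm_aeval_le_of_isStarNormal {H : Type*} [NormedAddCommGroup H] [InnerProductSpace ℂ H]
    [CompleteSpace H] {M : H →L[ℂ] H} (hM : IsStarNormal M) (p : ℂ[X]) {B : ℝ} (hB : 0 ≤ B)
    (h : ∀ z ∈ spectrum ℂ M, ‖p.eval z‖ ≤ B) : ‖aeval M p‖ ≤ B := by
  rw [← cfc_polynomial p M hM]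
  exact norm_cfc_le hB h

end OperatorKernel

/-! ### Chebyshev truncation from bounds on a horizontal line. -/

section ChebyshevApproximation

open Polynomial Complex

/-- Chebyshev expansion of a polynomial. -/
lemma exists_eq_sum_chebyshevT (F : ℂ[X]) :
    ∃ a : ℕ →₀ ℂ, F = ∑ j ∈ a.support, a j • Chebyshev.T ℂ j := by
  have hC : ∀ i, IsUnit (Chebyshev.chebyshevTsequence ℂ i).leadingCoeff := fun i => by
    rw [isUnit_iff_ne_zero, leadingCoeff_ne_zero]
    exact (Chebyshev.chebyshevTsequence ℂ).ne_zero i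
  let b := (Chebyshev.chebyshevTsequence ℂ).basis hC
  refine ⟨b.repr F, ?_⟩
  conv_lhs => rw [← b.linearCombination_repr F, Finsupp.linearCombination_apply, Finsupp.sum]
  refine Finset.sum_congr rfl fun j _ => ?_
  rw [Polynomial.Sequence.basis_eq_self]
  rfl

lemma integral_exp_int_mul_I (m : ℤ) :
    ∫ θ in (-Real.pi)..Real.pi, cexp (m * θ * I) = if m = 0 then 2 * Real.pi else 0 := by
  split_ifs with h
  · simp [h]; ring
  · have hc : (m * I : ℂ) ≠ 0 := by simp [h]
    have := integral_exp_mul_complex (a := -Real.pi) (b := Real.pi) hc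
    simp_rw [show ∀ θ : ℝ, (m * θ * I : ℂ) = m * I * θ from fun θ => by ring]
    rw [this]
    have e : cexp (m * I * (Real.pi : ℝ)) = cexp (m * I * (-Real.pi : ℝ)) := by
      rw [Complex.exp_eq_exp_iff_exists_int]
      exact ⟨m, by push_cast; ring⟩
    rw [e, sub_self, zero_div, ofReal_zero]

/-- Of the two exponentials in `cos (j w)`, only `exp (-i j w)`, of modulus `exp (j η)`, can cancel
the frequency `J ≥ 1`. This large factor is what makes the coefficients small. -/
lemma integral_cos_mul_exp (j J : ℕ) (hJ : 1 ≤ J) (η : ℝ) :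
    ∫ θ in (-Real.pi)..Real.pi, Complex.cos (j * (θ + η * I)) * cexp (J * θ * I) =
      if j = J then Real.pi * cexp (J * η) else 0 := by
  have h1 : ∀ θ : ℝ, Complex.cos (j * (θ + η * I)) * cexp (J * θ * I) =
      cexp (-(j * η)) / 2 * cexp (((j + J : ℤ) : ℂ) * θ * I) +
      cexp (j * η) / 2 * cexp (((J - j : ℤ) : ℂ) * θ * I) := fun θ => by
    rw [Complex.cos, div_mul_eq_mul_div, add_mul, ← Complex.exp_add, ← Complex.exp_add,
      div_mul_eq_mul_div, div_mul_eq_mul_div, ← Complex.exp_add, ← Complex.exp_add, add_div]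
    congr 3 <;> · push_cast; ring_nf; simp [I_sq]; try ring
  simp_rw [h1]
  rw [intervalIntegral.integral_add (Continuous.intervalIntegrable (by fun_prop) _ _)
    (Continuous.intervalIntegrable (by fun_prop) _ _), intervalIntegral.integral_const_mul,
    intervalIntegral.integral_const_mul, integral_exp_int_mul_I, integral_exp_int_mul_I,
    if_neg (by omega)]
  by_cases h : j = J
  · subst h; simp; ring
  · rw [if_neg (by omega), if_neg h]; simp

/-- A bound for the integral over a horizontal line bounds the Chebyshev coefficients. -/
lemma norm_chebyshev_coeff_le (a : ℕ →₀ ℂ) (J : ℕ) (hJ : 1 ≤ J) {η B : ℝ}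
    (hB : ∫ θ in (-Real.pi)..Real.pi,
      ‖(∑ j ∈ a.support, a j • Chebyshev.T ℂ j).eval (Complex.cos (θ + η * I))‖ ≤ B) :
    ‖a J‖ ≤ B / Real.pi * Real.exp (-(J * η)) := by
  have h1 : ∫ θ in (-Real.pi)..Real.pi,
      (∑ j ∈ a.support, a j • Chebyshev.T ℂ j).eval (Complex.cos (θ + η * I)) * cexp (J * θ * I)
      = a J * (Real.pi * cexp (J * η)) := by
    have h2 : ∀ θ : ℝ, (∑ j ∈ a.support, a j • Chebyshev.T ℂ j).eval (Complex.cos (θ + η * I)) *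
        cexp (J * θ * I) = ∑ j ∈ a.support,
          a j * (Complex.cos (j * (θ + η * I)) * cexp (J * θ * I)) := fun θ => by
      rw [eval_finsetSum, Finset.sum_mul]
      refine Finset.sum_congr rfl fun j _ => ?_
      rw [eval_smul, Chebyshev.T_complex_cos, smul_eq_mul, mul_assoc]
      simp
    simp_rw [h2]
    rw [intervalIntegral.integral_finsetSum
      fun j _ => Continuous.intervalIntegrable (by fun_prop) _ _]
    simp_rw [intervalIntegral.integral_const_mul, integral_cos_mul_exp _ J hJ]
    simp
  have hπ := Real.pi_pos
  have h3 : ‖a J‖ * (Real.pi * Real.exp (J * η)) ≤ B := by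
    have h4 := congrArg norm h1
    rw [norm_mul, norm_mul, Complex.norm_exp, Complex.norm_real, Real.norm_of_nonneg hπ.le] at h4
    have h5 : ((J : ℂ) * η).re = J * η := by simp
    rw [h5] at h4
    rw [← h4]
    refine (intervalIntegral.norm_integral_le_integral_norm (by linarith)).trans (le_trans ?_ hB)
    refine le_of_eq (intervalIntegral.integral_congr fun θ _ => ?_)
    simp [Complex.norm_exp]
  rw [Real.exp_neg, ← div_eq_mul_inv, div_div, le_div_iff₀ (by positivity)]
  exact h3

/-- Truncating the Chebyshev expansion: a bound on a horizontal line gives an approximation. -/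
lemma exists_polynomial_approx (F : ℂ[X]) (m : ℕ) {η B : ℝ} (hη : 0 < η)
    (hB : ∫ θ in (-Real.pi)..Real.pi, ‖F.eval (Complex.cos (θ + η * I))‖ ≤ B) :
    ∃ P : ℂ[X], P.natDegree ≤ m ∧ ∀ v ∈ Set.Icc (-1 : ℝ) 1,
      ‖F.eval (v : ℂ) - P.eval (v : ℂ)‖ ≤
        B / Real.pi * (Real.exp (-((m + 1) * η)) / (1 - Real.exp (-η))) := by
  obtain ⟨a, rfl⟩ := exists_eq_sum_chebyshevT F
  have hB0 : 0 ≤ B := le_trans (intervalIntegral.integral_nonneg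
    (by linarith [Real.pi_pos]) fun _ _ => norm_nonneg _) hB
  refine ⟨∑ j ∈ a.support with j ≤ m, a j • Chebyshev.T ℂ j, ?_, fun v hv => ?_⟩
  · refine natDegree_sum_le_of_forall_le _ _ fun j hj => ?_
    refine (natDegree_smul_le _ _).trans ?_
    simpa using (Finset.mem_filter.1 hj).2
  · rw [← eval_sub, ← Finset.sum_filter_add_sum_filter_not a.support (fun j => j ≤ m),
      add_sub_cancel_left, eval_finsetSum]
    refine (norm_sum_le _ _).trans ?_
    have hq0 := Real.exp_pos (-η)
    have hq1 : Real.exp (-η) < 1 := Real.exp_lt_one_iff.2 (by linarith)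
    have hterm : ∀ j ∈ a.support.filter (fun j => ¬ j ≤ m),
        ‖(a j • Chebyshev.T ℂ j).eval (v : ℂ)‖ ≤ B / Real.pi * Real.exp (-η) ^ j := fun j hj => by
      have hj' := (Finset.mem_filter.1 hj).2
      rw [eval_smul, norm_smul, ← Chebyshev.complex_ofReal_eval_T, Complex.norm_real]
      have h1 := norm_chebyshev_coeff_le a j (by omega) hB
      have h2 := Chebyshev.abs_eval_T_real_le_one j (abs_le.2 hv)
      rw [← Real.exp_nat_mul, show (j : ℝ) * -η = -(j * η) by ring]
      calc _ ≤ ‖a j‖ * 1 := by gcongr; exact h2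
        _ ≤ _ := by rw [mul_one]; exact h1
    refine (Finset.sum_le_sum hterm).trans ?_
    rw [← Finset.mul_sum]
    have hπ := Real.pi_pos
    gcongr
    have hgeo : HasSum (fun i => Real.exp (-η) ^ (i + (m + 1)))
        (Real.exp (-((m + 1) * η)) / (1 - Real.exp (-η))) := by
      have h := (hasSum_geometric_of_lt_one hq0.le hq1).mul_right (Real.exp (-η) ^ (m + 1))
      simp_rw [← pow_add] at h
      rw [← Real.exp_nat_mul, mul_comm, ← div_eq_mul_inv] at h
      rwa [show ((m + 1 : ℕ) : ℝ) * -η = -((m + 1) * η) by push_cast; ring] at h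
    -- Shifting indices by `m + 1` exhibits the finite sum as a partial sum of the geometric tail.
    have : ∑ j ∈ a.support with ¬ j ≤ m, Real.exp (-η) ^ j =
        ∑ i ∈ (a.support.filter fun j => ¬ j ≤ m).image (fun j => j - (m + 1)),
          Real.exp (-η) ^ (i + (m + 1)) := by
      rw [Finset.sum_image]
      · refine Finset.sum_congr rfl fun j hj => ?_
        have hj' := (Finset.mem_filter.1 hj).2
        congr 1; omega
      · intro i hi j hj hij
        have := (Finset.mem_filter.1 hi).2
        have := (Finset.mem_filter.1 hj).2
        simp only at hij
        omega
    rw [this]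
    exact sum_le_hasSum _ (fun _ _ => by positivity) hgeo

end ChebyshevApproximation

/-! ### Size of `1 - u ^ k` off the real axis. -/

section PointwiseEstimate

/-- The left side carries a factor `y`: when `y ≤ δ x` it is a small multiple of `x ^ (d + 1)`, and
otherwise `x` is controlled by `y`. With `x = |θ|`, `y = η`, this absorbs the cost of leaving the
real axis into the decay along it. -/
lemma exists_weighted_young (d : ℕ) {K c : ℝ} (hK : 0 < K) (hc : 0 < c) :
    ∃ C : ℝ, 0 < C ∧ ∀ x y : ℝ, 0 ≤ x → 0 ≤ y →
      K * y * (x + y) ^ d ≤ c * x ^ (d + 1) + C * y ^ (d + 1) := by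
  set δ := min 1 (c / (K * 2 ^ d)) with hδ
  have hδ0 : 0 < δ := lt_min one_pos (by positivity)
  have hδc : δ * (K * 2 ^ d) ≤ c := (le_div_iff₀ (by positivity)).1 (min_le_right _ _)
  refine ⟨K * (1 / δ + 1) ^ d, by positivity, fun x y hx hy => ?_⟩
  by_cases h : y ≤ δ * x
  · have h1 : y ≤ x := h.trans (mul_le_of_le_one_left hx (min_le_left _ _))
    calc K * y * (x + y) ^ d ≤ K * (δ * x) * (2 * x) ^ d := by gcongr; linarith
      _ = δ * (K * 2 ^ d) * x ^ (d + 1) := by ring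
      _ ≤ c * x ^ (d + 1) := by gcongr
      _ ≤ _ := le_add_of_nonneg_right (by positivity)
  · have h1 : x ≤ 1 / δ * y := by
      rw [one_div, ← div_eq_inv_mul, le_div_iff₀ hδ0]
      linarith
    calc K * y * (x + y) ^ d ≤ K * y * (1 / δ * y + y) ^ d := by gcongr
      _ = K * (1 / δ + 1) ^ d * y ^ (d + 1) := by
        rw [show 1 / δ * y + y = (1 / δ + 1) * y by ring, mul_pow]; ring
      _ ≤ _ := le_add_of_nonneg_left (by positivity)

lemma exists_one_add_pow_le_exp (N d : ℕ) (hd : 1 ≤ d) {c : ℝ} (hc : 0 < c) :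
    ∃ C : ℝ, 0 < C ∧ ∀ x : ℝ, 0 ≤ x → (1 + x) ^ N ≤ C * Real.exp (c * x ^ d) := by
  refine ⟨N.factorial / c ^ N * Real.exp (2 * c), by positivity, fun x hx => ?_⟩
  have h1 := Real.pow_div_factorial_le_exp (c * (1 + x)) (by positivity) N
  have h2 : x ≤ 1 + x ^ d := by
    rcases le_total x 1 with h | h
    · linarith [pow_nonneg hx d]
    · linarith [le_self_pow₀ h (by omega : d ≠ 0)]
  have h3 : Real.exp (c * (1 + x)) ≤ Real.exp (2 * c) * Real.exp (c * x ^ d) := by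
    rw [← Real.exp_add, Real.exp_le_exp]
    nlinarith
  rw [div_le_iff₀ (by positivity), mul_pow] at h1
  rw [mul_assoc, div_mul_eq_mul_div, le_div_iff₀ (by positivity)]
  calc (1 + x) ^ N * c ^ N ≤ Real.exp (c * (1 + x)) * N.factorial := by linarith
    _ ≤ (Real.exp (2 * c) * Real.exp (c * x ^ d)) * N.factorial := by gcongr
    _ = _ := by ring

/-- The factor `|θ| + η`, due to the critical point of `cos` at `0`, keeps the bound homogeneous of
degree two, like `1 - cos` itself. -/
lemma norm_cos_sub_cos_add_le (θ : ℝ) {η : ℝ} (h0 : 0 ≤ η) (h1 : η ≤ 1) :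
    ‖(Real.cos θ : ℂ) - Complex.cos (θ + η * Complex.I)‖ ≤ 2 * η * (|θ| + η) := by
  have e := Real.abs_exp_sub_one_sub_id_le (x := η) (by rwa [abs_of_nonneg h0])
  have e' := Real.abs_exp_sub_one_sub_id_le (x := -η) (by rwa [abs_neg, abs_of_nonneg h0])
  rw [abs_le] at e e'
  have hc : Real.cosh η - 1 ≤ η ^ 2 := by rw [Real.cosh_eq]; linarith [e.2, e'.2, neg_sq η]
  have hc0 := Real.one_le_cosh η
  have hs : Real.sinh η ≤ 2 * η := by
    rw [Real.sinh_eq]; nlinarith [e.2, e'.1, neg_sq η]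
  have hs0 : 0 ≤ Real.sinh η := Real.sinh_nonneg_iff.2 h0
  have key : (Real.cos θ : ℂ) - Complex.cos (θ + η * Complex.I) =
      ((Real.cos θ * (1 - Real.cosh η) : ℝ) : ℂ) +
        ((Real.sin θ * Real.sinh η : ℝ) : ℂ) * Complex.I := by
    rw [Complex.cos_add_mul_I]
    push_cast
    ring
  rw [key]
  refine (norm_add_le _ _).trans ?_
  rw [norm_mul, Complex.norm_I, mul_one, Complex.norm_real, Complex.norm_real, Real.norm_eq_abs,
    Real.norm_eq_abs, abs_mul, abs_mul, abs_of_nonneg hs0, abs_sub_comm,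
    abs_of_nonneg (by linarith : (0 : ℝ) ≤ Real.cosh η - 1)]
  have a1 : |Real.cos θ| * (Real.cosh η - 1) ≤ 1 * η ^ 2 :=
    mul_le_mul (Real.abs_cos_le_one θ) hc (by linarith) zero_le_one
  have a2 : |Real.sin θ| * Real.sinh η ≤ |θ| * (2 * η) :=
    mul_le_mul Real.abs_sin_le_abs hs hs0 (abs_nonneg _)
  nlinarith [abs_nonneg θ]

lemma norm_pow_sub_pow_le_of_norm_le {x y : ℂ} {R : ℝ} (k : ℕ) (hx : ‖x‖ ≤ R) (hy : ‖y‖ ≤ R) :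
    ‖x ^ k - y ^ k‖ ≤ k * R ^ (k - 1) * ‖x - y‖ := by
  rw [← (Commute.all x y).geom_sum₂_mul, norm_mul]
  gcongr
  refine (norm_sum_le _ _).trans ?_
  have : ∀ i ∈ Finset.range k, ‖x ^ i * y ^ (k - 1 - i)‖ ≤ R ^ (k - 1) := fun i hi => by
    have hi' := Finset.mem_range.1 hi
    rw [norm_mul, norm_pow, norm_pow]
    calc _ ≤ R ^ i * R ^ (k - 1 - i) := by
          have := (norm_nonneg x).trans hx
          gcongr
      _ = _ := by rw [← pow_add]; congr 1; omega
  simpa using Finset.sum_le_card_nsmul _ _ _ this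

variable {k : ℕ} {b : ℝ}

/-- On the real axis `b (θ / π) ^ 2 ≤ u ≤ b`. The lower bound keeps `1 - u ^ k` away from `1`, with
constant `b ^ k`; the upper bound keeps it away from `-1`, with constant `2 - b ^ k`. -/
lemma abs_one_sub_pow_le (hb : 0 < b) (hb2 : b ^ k < 2) {θ : ℝ} (hθ : |θ| ≤ Real.pi) :
    |1 - (b / 2 * (1 - Real.cos θ)) ^ k| ≤
      1 - min (b ^ k) (2 - b ^ k) / Real.pi ^ (2 * k) * |θ| ^ (2 * k) := by
  have hπ := Real.pi_pos
  set u := b / 2 * (1 - Real.cos θ) with hu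
  have hub : u ≤ b := by rw [hu]; nlinarith [Real.neg_one_le_cos θ]
  have hl : b * (|θ| ^ 2 / Real.pi ^ 2) ≤ u := by
    have h := Real.cos_le_one_sub_mul_cos_sq hθ
    rw [hu, sq_abs]
    have : b / 2 * (2 / Real.pi ^ 2 * θ ^ 2) ≤ b / 2 * (1 - Real.cos θ) := by gcongr; linarith
    calc _ = b / 2 * (2 / Real.pi ^ 2 * θ ^ 2) := by ring
      _ ≤ _ := this
  have hu0 : 0 ≤ u := le_trans (by positivity) hl
  have hlk : b ^ k * (|θ| ^ (2 * k) / Real.pi ^ (2 * k)) ≤ u ^ k := by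
    rw [pow_mul, pow_mul, ← div_pow, ← mul_pow]
    exact pow_le_pow_left₀ (by positivity) hl k
  have hubk : u ^ k ≤ b ^ k := pow_le_pow_left₀ hu0 hub k
  have hr0 : 0 ≤ |θ| ^ (2 * k) / Real.pi ^ (2 * k) := by positivity
  have hr1 : |θ| ^ (2 * k) / Real.pi ^ (2 * k) ≤ 1 :=
    div_le_one_of_le₀ (pow_le_pow_left₀ (abs_nonneg _) hθ _) (by positivity)
  have hbk : 0 < b ^ k := by positivity
  rw [div_mul_eq_mul_div, mul_div_assoc]
  set r := |θ| ^ (2 * k) / Real.pi ^ (2 * k)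
  rw [abs_le]
  constructor
  · nlinarith [mul_le_mul_of_nonneg_right (min_le_right (b ^ k) (2 - b ^ k)) hr0]
  · nlinarith [mul_le_mul_of_nonneg_right (min_le_left (b ^ k) (2 - b ^ k)) hr0]

lemma norm_one_sub_cos_le (hb : 0 < b) (θ : ℝ) {η : ℝ} (h0 : 0 ≤ η) (h1 : η ≤ 1) :
    ‖(b / 2 : ℂ) * (1 - Complex.cos (θ + η * Complex.I))‖ ≤ b * (|θ| + η) ^ 2 := by
  have h2 := norm_cos_sub_cos_add_le θ h0 h1
  have h3 : |1 - Real.cos θ| ≤ |θ| ^ 2 / 2 := by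
    rw [abs_of_nonneg (by linarith [Real.cos_le_one θ]), sq_abs]
    linarith [Real.one_sub_sq_div_two_le_cos (x := θ)]
  have h4 : ‖1 - Complex.cos (θ + η * Complex.I)‖ ≤ |θ| ^ 2 / 2 + 2 * η * (|θ| + η) := by
    calc _ = ‖((1 - Real.cos θ : ℝ) : ℂ) +
          ((Real.cos θ : ℂ) - Complex.cos (θ + η * Complex.I))‖ := by
            congr 1; push_cast; ring
      _ ≤ _ := (norm_add_le _ _).trans (by
            rw [Complex.norm_real, Real.norm_eq_abs]; exact add_le_add h3 h2)
  have hbn : ‖(b / 2 : ℂ)‖ = b / 2 := by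
    rw [← Complex.ofReal_ofNat, ← Complex.ofReal_div, Complex.norm_real,
      Real.norm_of_nonneg (by positivity)]
  rw [norm_mul, hbn]
  calc _ ≤ b / 2 * (|θ| ^ 2 / 2 + 2 * η * (|θ| + η)) := by gcongr
    _ ≤ b / 2 * (2 * (|θ| + η) ^ 2) := by
      gcongr
      nlinarith [mul_nonneg (abs_nonneg θ) h0, sq_nonneg |θ|]
    _ = _ := by ring

/-- The basic estimate for `1 - u ^ k` near the real axis, in the parametrisation
`u = b (1 - cos w) / 2`. -/
lemma exists_norm_one_sub_pow_le (hk : 1 ≤ k) (hb : 0 < b) (hb2 : b ^ k < 2) :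
    ∃ c C : ℝ, 0 < c ∧ 0 < C ∧ ∀ θ η : ℝ, |θ| ≤ Real.pi → 0 ≤ η → η ≤ 1 →
      ‖1 - ((b / 2 : ℂ) * (1 - Complex.cos (θ + η * Complex.I))) ^ k‖ ≤
        Real.exp (-c * |θ| ^ (2 * k) + C * η ^ (2 * k)) := by
  obtain ⟨d, hd⟩ : ∃ d, 2 * k = d + 1 := ⟨2 * k - 1, by omega⟩
  have hbk : 0 < b ^ k := by positivity
  set c₂ := min (b ^ k) (2 - b ^ k) / Real.pi ^ (2 * k) with hc₂
  have hc₂0 : 0 < c₂ := div_pos (lt_min hbk (by linarith)) (by positivity)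
  have hk0 : (0 : ℝ) < k := by exact_mod_cast hk
  obtain ⟨C, hC, hY⟩ := exists_weighted_young d (K := k * b ^ k) (by positivity) (half_pos hc₂0)
  refine ⟨c₂ / 2, C, half_pos hc₂0, hC, fun θ η hθ h0 h1 => ?_⟩
  -- `u` is compared with its value `u₀` at `η = 0`, where the real estimate applies; the difference
  -- of the `k`-th powers is `O(η (|θ| + η) ^ (2k - 1))`.
  set u : ℂ := (b / 2 : ℂ) * (1 - Complex.cos (θ + η * Complex.I)) with hu
  set u₀ : ℝ := b / 2 * (1 - Real.cos θ) with hu₀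
  have hu1 : ‖u‖ ≤ b * (|θ| + η) ^ 2 := norm_one_sub_cos_le hb θ h0 h1
  have hu2 : ‖(u₀ : ℂ)‖ ≤ b * (|θ| + η) ^ 2 := by
    have := norm_one_sub_cos_le hb θ le_rfl zero_le_one
    calc ‖(u₀ : ℂ)‖ = _ := by rw [hu₀]; push_cast; simp
      _ ≤ _ := this
      _ ≤ _ := by gcongr
  have hbn : ‖(b / 2 : ℂ)‖ = b / 2 := by
    rw [← Complex.ofReal_ofNat, ← Complex.ofReal_div, Complex.norm_real,
      Real.norm_of_nonneg (by positivity)]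
  have hd1 : ‖(u₀ : ℂ) - u‖ ≤ b * η * (|θ| + η) := by
    have : (u₀ : ℂ) - u =
        -((b / 2 : ℂ) * ((Real.cos θ : ℂ) - Complex.cos (θ + η * Complex.I))) := by
      rw [hu₀, hu]; push_cast; ring
    rw [this, norm_neg, norm_mul, hbn]
    calc _ ≤ b / 2 * (2 * η * (|θ| + η)) := by
          gcongr; exact norm_cos_sub_cos_add_le θ h0 h1
      _ = _ := by ring
  have hp : ‖(u₀ : ℂ) ^ k - u ^ k‖ ≤ k * b ^ k * η * (|θ| + η) ^ d := by
    have h := norm_pow_sub_pow_le_of_norm_le k hu2 hu1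
    refine h.trans ?_
    calc _ ≤ k * (b * (|θ| + η) ^ 2) ^ (k - 1) * (b * η * (|θ| + η)) := by gcongr
      _ = _ := by
        obtain ⟨j, rfl⟩ : ∃ j, k = j + 1 := ⟨k - 1, by omega⟩
        obtain rfl : d = 2 * j + 1 := by omega
        rw [Nat.add_sub_cancel, mul_pow, ← pow_mul]
        ring
  have hr := abs_one_sub_pow_le (k := k) hb hb2 hθ
  have hyy := hY |θ| η (abs_nonneg _) h0
  rw [← hd] at hyy
  have h3 : ‖1 - u ^ k‖ ≤ (-(c₂ / 2) * |θ| ^ (2 * k) + C * η ^ (2 * k)) + 1 := by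
    calc ‖1 - u ^ k‖ = ‖((1 - u₀ ^ k : ℝ) : ℂ) + ((u₀ : ℂ) ^ k - u ^ k)‖ := by
          congr 1; push_cast; ring
      _ ≤ |1 - u₀ ^ k| + ‖(u₀ : ℂ) ^ k - u ^ k‖ := by
          refine (norm_add_le _ _).trans ?_
          rw [Complex.norm_real, Real.norm_eq_abs]
      _ ≤ _ := by linarith
  exact h3.trans (Real.add_one_le_exp _)

end PointwiseEstimate

/-! ### Approximation of `u ^ ℓ (1 - u ^ k) ^ n` with sub-Gaussian error. -/

section PolynomialApproximation

open Polynomial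

/-- The polynomial `u ^ ℓ (1 - u ^ k) ^ n` in the variable `v`, where `u = b (1 - v) / 2`. -/
noncomputable def laplacianPoly (b : ℝ) (k ℓ n : ℕ) : ℂ[X] :=
  (C (b / 2 : ℂ) * (1 - X)) ^ ℓ * (1 - (C (b / 2 : ℂ) * (1 - X)) ^ k) ^ n

lemma eval_laplacianPoly (b : ℝ) (k ℓ n : ℕ) (z : ℂ) :
    (laplacianPoly b k ℓ n).eval z =
      ((b / 2 : ℂ) * (1 - z)) ^ ℓ * (1 - ((b / 2 : ℂ) * (1 - z)) ^ k) ^ n := by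
  simp [laplacianPoly]

lemma natDegree_laplacianPoly_le (b : ℝ) (k ℓ n : ℕ) :
    (laplacianPoly b k ℓ n).natDegree ≤ k * n + ℓ := by
  have h1 : (C (b / 2 : ℂ) * (1 - X)).natDegree ≤ 1 := by compute_degree
  have h2 : ((C (b / 2 : ℂ) * (1 - X)) ^ k).natDegree ≤ k := by
    simpa only [mul_one] using natDegree_pow_le_of_le k h1
  have h3 : (1 - (C (b / 2 : ℂ) * (1 - X)) ^ k).natDegree ≤ k :=
    (natDegree_sub_le _ _).trans (max_le (by simp) h2)
  refine natDegree_mul_le_of_le (natDegree_pow_le_of_le ℓ h1) (natDegree_pow_le_of_le n h3)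
    |>.trans ?_
  linarith [mul_comm k n]

variable {k : ℕ} {b : ℝ}

/-- Bounds on the Chebyshev ellipses, with Gaussian-type growth in the direction transversal to
the interval and integrable decay along it. -/
lemma exists_norm_laplacianPoly_le (hk : 1 ≤ k) (hb : 0 < b) (hb2 : b ^ k < 2) :
    ∃ A : ℝ, 0 < A ∧ ∀ ℓ : ℕ, ∃ K : ℝ, 0 < K ∧ ∀ (n : ℕ) (σ θ η : ℝ), 0 < σ →
      σ ^ (2 * k) = n → |θ| ≤ Real.pi → 0 ≤ η → η ≤ 1 →
      ‖(laplacianPoly b k ℓ n).eval (Complex.cos (θ + η * Complex.I))‖ ≤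
        K / σ ^ (2 * ℓ) * Real.exp (A * (σ * η) ^ (2 * k)) * (1 + (σ * θ) ^ 2)⁻¹ := by
  obtain ⟨c, C₁, hc, hC₁, h1⟩ := exists_norm_one_sub_pow_le hk hb hb2
  refine ⟨C₁ + 1, by linarith, fun ℓ => ?_⟩
  -- The power `2 * ℓ` pays for `u ^ ℓ`, the extra `2` for the integrable weight. The rates `c` and
  -- `1` do not involve `ℓ`, so `A` does not depend on `ℓ`.
  obtain ⟨K₁, hK₁, hX⟩ := exists_one_add_pow_le_exp (2 * ℓ + 2) (2 * k) (by omega) hc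
  obtain ⟨K₂, hK₂, hY⟩ := exists_one_add_pow_le_exp (2 * ℓ) (2 * k) (by omega) one_pos
  refine ⟨b ^ ℓ * K₁ * K₂, by positivity, fun n σ θ η hσ hσn hθ h0 h1' => ?_⟩
  have hu := norm_one_sub_cos_le hb θ h0 h1'
  have hv := h1 θ η hθ h0 h1'
  rw [eval_laplacianPoly, norm_mul, norm_pow, norm_pow]
  have hX' := hX (σ * |θ|) (by positivity)
  have hY' := hY (σ * η) (by positivity)
  set x := σ * |θ| with hx
  set y := σ * η with hy
  have hx0 : 0 ≤ x := by positivity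
  have hy0 : 0 ≤ y := by positivity
  have e1 : (b * (|θ| + η) ^ 2) ^ ℓ = b ^ ℓ / σ ^ (2 * ℓ) * (x + y) ^ (2 * ℓ) := by
    rw [hx, hy, ← mul_add, mul_pow, mul_pow, ← pow_mul]
    field_simp
  have e2 : Real.exp (-c * |θ| ^ (2 * k) + C₁ * η ^ (2 * k)) ^ n =
      Real.exp (C₁ * y ^ (2 * k)) / Real.exp (c * x ^ (2 * k)) := by
    rw [← Real.exp_nat_mul, ← Real.exp_sub, ← hσn, hx, hy, mul_pow, mul_pow]
    ring_nf
  have e3 : (σ * θ) ^ 2 = x ^ 2 := by rw [hx, mul_pow, mul_pow, sq_abs]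
  have e4 : (x + y) ^ (2 * ℓ) ≤ (1 + x) ^ (2 * ℓ) * (1 + y) ^ (2 * ℓ) := by
    rw [← mul_pow]
    gcongr
    nlinarith
  have e5 : (1 + x) ^ (2 * ℓ) / Real.exp (c * x ^ (2 * k)) ≤ K₁ * (1 + x ^ 2)⁻¹ := by
    rw [div_le_iff₀ (Real.exp_pos _), mul_assoc, mul_left_comm, ← div_eq_inv_mul,
      le_div_iff₀ (by positivity)]
    refine le_trans ?_ hX'
    rw [pow_add]
    gcongr
    nlinarith
  rw [e3]
  calc _ ≤ (b * (|θ| + η) ^ 2) ^ ℓ * Real.exp (-c * |θ| ^ (2 * k) + C₁ * η ^ (2 * k)) ^ n := by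
        gcongr
    _ ≤ b ^ ℓ / σ ^ (2 * ℓ) * ((1 + x) ^ (2 * ℓ) * (1 + y) ^ (2 * ℓ)) *
        (Real.exp (C₁ * y ^ (2 * k)) / Real.exp (c * x ^ (2 * k))) := by
        rw [e1, e2]
        gcongr
    _ = b ^ ℓ / σ ^ (2 * ℓ) * (1 + y) ^ (2 * ℓ) * Real.exp (C₁ * y ^ (2 * k)) *
        ((1 + x) ^ (2 * ℓ) / Real.exp (c * x ^ (2 * k))) := by ring
    _ ≤ b ^ ℓ / σ ^ (2 * ℓ) * (K₂ * Real.exp (1 * y ^ (2 * k))) * Real.exp (C₁ * y ^ (2 * k)) *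
        (K₁ * (1 + x ^ 2)⁻¹) := by gcongr
    _ = _ := by
        rw [add_mul, Real.exp_add]
        ring

lemma integral_inv_one_add_sq_scaled_le {σ : ℝ} (hσ : 0 < σ) :
    ∫ θ in (-Real.pi)..Real.pi, (1 + (σ * θ) ^ 2)⁻¹ ≤ Real.pi / σ := by
  have hint : Integrable fun θ : ℝ => (1 + (σ * θ) ^ 2)⁻¹ :=
    integrable_inv_one_add_sq.comp_mul_left' hσ.ne'
  have h := Measure.integral_comp_mul_left (fun x : ℝ => (1 + x ^ 2)⁻¹) σ
  rw [integral_univ_inv_one_add_sq, abs_of_pos (inv_pos.2 hσ), smul_eq_mul, ← div_eq_inv_mul] at h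
  rw [← h, intervalIntegral.integral_of_le (by linarith [Real.pi_pos])]
  exact setIntegral_le_integral hint (Filter.Eventually.of_forall fun _ => by positivity)

/-- Polynomial approximation with a free parameter `η`, the width of the Chebyshev ellipse. -/
lemma exists_approx_laplacianPoly_of_width (hk : 1 ≤ k) (hb : 0 < b) (hb2 : b ^ k < 2) :
    ∃ A : ℝ, 0 < A ∧ ∀ ℓ : ℕ, ∃ K : ℝ, 0 < K ∧ ∀ (n m : ℕ) (σ η r : ℝ), 0 < σ →
      σ ^ (2 * k) = n → r ≤ m + 1 →
      (∀ v ∈ Set.Icc (-1 : ℝ) 1, ‖(laplacianPoly b k ℓ n).eval (v : ℂ)‖ ≤ K / σ ^ (2 * ℓ)) ∧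
      (0 < η → η ≤ 1 → ∃ P : ℂ[X], P.natDegree ≤ m ∧ ∀ v ∈ Set.Icc (-1 : ℝ) 1,
        ‖(laplacianPoly b k ℓ n).eval (v : ℂ) - P.eval (v : ℂ)‖ ≤
          K / σ ^ (2 * ℓ) / (σ * η) * Real.exp (A * (σ * η) ^ (2 * k) - r * η)) := by
  obtain ⟨A, hA, h⟩ := exists_norm_laplacianPoly_le hk hb hb2
  refine ⟨A, hA, fun ℓ => ?_⟩
  obtain ⟨K, hK, hF⟩ := h ℓ
  refine ⟨2 * K, by positivity, fun n m σ η r hσ hσn hr => ⟨fun v hv => ?_, fun h0 h1 => ?_⟩⟩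
  · have hθ : |Real.arccos v| ≤ Real.pi := by
      rw [abs_of_nonneg (Real.arccos_nonneg v)]; exact Real.arccos_le_pi v
    have h2 := hF n σ (Real.arccos v) 0 hσ hσn hθ le_rfl zero_le_one
    have e : Complex.cos ((Real.arccos v : ℂ) + (0 : ℝ) * Complex.I) = v := by
      rw [Complex.ofReal_zero, zero_mul, add_zero, ← Complex.ofReal_cos,
        Real.cos_arccos hv.1 hv.2]
    rw [e, mul_zero, zero_pow (by omega), mul_zero, Real.exp_zero, mul_one] at h2
    refine h2.trans ?_
    have h3 : (1 + (σ * Real.arccos v) ^ 2)⁻¹ ≤ 1 := inv_le_one_of_one_le₀ (by nlinarith)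
    calc _ ≤ K / σ ^ (2 * ℓ) * 1 := by gcongr
      _ ≤ _ := by rw [mul_one]; gcongr; linarith
  · have hπ := Real.pi_pos
    set D := K / σ ^ (2 * ℓ) * Real.exp (A * (σ * η) ^ (2 * k)) with hD
    have hint : ∫ θ in (-Real.pi)..Real.pi,
        ‖(laplacianPoly b k ℓ n).eval (Complex.cos (θ + η * Complex.I))‖ ≤ D * (Real.pi / σ) := by
      calc _ ≤ ∫ θ in (-Real.pi)..Real.pi, D * (1 + (σ * θ) ^ 2)⁻¹ := by
            refine intervalIntegral.integral_mono_on (by linarith)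
              (Continuous.intervalIntegrable (by fun_prop) _ _)
              (Continuous.intervalIntegrable ?_ _ _) fun θ hθ =>
                hF n σ θ η hσ hσn (abs_le.2 hθ) h0.le h1
            exact continuous_const.mul (Continuous.inv₀ (by fun_prop) fun θ => by positivity)
        _ ≤ _ := by
            rw [intervalIntegral.integral_const_mul]
            gcongr
            exact integral_inv_one_add_sq_scaled_le hσ
    obtain ⟨P, hPd, hP⟩ := exists_polynomial_approx (laplacianPoly b k ℓ n) m h0 hint
    refine ⟨P, hPd, fun v hv => (hP v hv).trans ?_⟩
    -- The geometric sum costs `2 / η`; together with the `1 / σ` gained by integrating the weight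
    -- this is `2 / (σ η)`, which explains the constant `2 * K`.
    have h3 : η / 2 ≤ 1 - Real.exp (-η) := by
      have e3 : Real.exp (-η) ≤ 1 / (1 + η) := by
        rw [Real.exp_neg, one_div]
        exact inv_anti₀ (by linarith) (by linarith [Real.add_one_le_exp η])
      have e4 : 1 / (1 + η) ≤ 1 - η / 2 := by
        rw [div_le_iff₀ (by linarith)]; nlinarith
      linarith
    have h4 : Real.exp (-((m + 1) * η)) ≤ Real.exp (-(r * η)) := by
      rw [Real.exp_le_exp]
      nlinarith
    calc D * (Real.pi / σ) / Real.pi * (Real.exp (-((m + 1) * η)) / (1 - Real.exp (-η)))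
        ≤ D * (Real.pi / σ) / Real.pi * (Real.exp (-(r * η)) / (η / 2)) := by gcongr
      _ = _ := by
        rw [hD, Real.exp_sub, Real.exp_neg]
        field_simp

/-- Polynomial approximation with sub-Gaussian rate, up to a constant. -/
lemma exists_approx_laplacianPoly (hk : 1 ≤ k) (hb : 0 < b) (hb2 : b ^ k < 2) :
    ∃ c : ℝ, 0 < c ∧ ∀ ℓ : ℕ, ∃ K : ℝ, 0 < K ∧ ∀ (n m : ℕ) (σ r : ℝ), 1 ≤ σ →
      σ ^ (2 * k) = n → 0 ≤ r → r ≤ m + 1 →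
      (∀ v ∈ Set.Icc (-1 : ℝ) 1, ‖(laplacianPoly b k ℓ n).eval (v : ℂ)‖ ≤ K / σ ^ (2 * ℓ)) ∧
      ∃ P : ℂ[X], P.natDegree ≤ m ∧ ∀ v ∈ Set.Icc (-1 : ℝ) 1,
        ‖(laplacianPoly b k ℓ n).eval (v : ℂ) - P.eval (v : ℂ)‖ ≤
          K / σ ^ (2 * ℓ) * Real.exp (-c * (r / σ) ^ (2 * (k : ℝ) / (2 * (k : ℝ) - 1))) := by
  obtain ⟨A, hA, h⟩ := exists_approx_laplacianPoly_of_width hk hb hb2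
  have hk1 : (1 : ℝ) ≤ k := by exact_mod_cast hk
  set q : ℝ := 2 * (k : ℝ) / (2 * (k : ℝ) - 1) with hq
  have hq0 : 0 < q := div_pos (by linarith) (by linarith)
  -- Small enough that the linear gain `r η` beats `A (σ η) ^ (2k)` with room to spare, and that the
  -- width `η` chosen below stays at most `1`.
  set ε : ℝ := 1 / (A + 1 + k) with hε
  have hε0 : 0 < ε := by positivity
  refine ⟨ε ^ q, by positivity, fun ℓ => ?_⟩
  obtain ⟨K, hK, hF⟩ := h ℓ
  -- A bound for `r / σ` in the range `n ≤ ℓ`; enlarging `K` to `K'` lets the zero polynomial serve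
  -- there.
  set R : ℝ := (k + 1) * ℓ with hR
  have hR0 : 0 ≤ R := by positivity
  set K' := K * Real.exp (1 + ε ^ q * R ^ q) with hK'
  have hKK : K ≤ K' := le_mul_of_one_le_right hK.le (Real.one_le_exp (by positivity))
  refine ⟨K', by positivity, fun n m σ r hσ hσn hr0 hrm => ?_⟩
  have hσ0 : 0 < σ := by linarith
  have hn1 : (1 : ℝ) ≤ n := by rw [← hσn]; exact one_le_pow₀ hσ
  refine ⟨fun v hv => ((hF n m σ 1 r hσ0 hσn hrm).1 v hv).trans (by gcongr), ?_⟩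
  have trivial_case : ∀ Z : ℝ, Z ≤ 1 + ε ^ q * R ^ q → ∃ P : ℂ[X], P.natDegree ≤ m ∧
      ∀ v ∈ Set.Icc (-1 : ℝ) 1,
        ‖(laplacianPoly b k ℓ n).eval (v : ℂ) - P.eval (v : ℂ)‖ ≤
          K' / σ ^ (2 * ℓ) * Real.exp (-Z) := fun Z hZ => by
    refine ⟨0, by simp, fun v hv => ?_⟩
    rw [eval_zero, sub_zero]
    refine ((hF n m σ 1 r hσ0 hσn hrm).1 v hv).trans ?_
    rw [hK', div_mul_eq_mul_div, mul_assoc, ← Real.exp_add]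
    gcongr
    exact le_mul_of_one_le_right hK.le (Real.one_le_exp (by linarith))
  by_cases hm : k * n + ℓ ≤ m
  · refine ⟨laplacianPoly b k ℓ n, (natDegree_laplacianPoly_le b k ℓ n).trans hm, fun v _ => ?_⟩
    rw [sub_self, norm_zero]
    positivity
  have hr : r ≤ k * n + ℓ := by
    have : (m : ℝ) + 1 ≤ k * n + ℓ := by exact_mod_cast not_le.1 hm
    linarith
  rw [neg_mul]
  by_cases hn : n ≤ ℓ
  · refine trivial_case _ ?_
    have hnl : (n : ℝ) ≤ ℓ := by exact_mod_cast hn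
    have hrR : r / σ ≤ R := (div_le_self hr0 hσ).trans (hr.trans (by rw [hR]; nlinarith))
    have := Real.rpow_le_rpow (by positivity) hrR hq0.le
    have : ε ^ q * (r / σ) ^ q ≤ ε ^ q * R ^ q := by gcongr
    linarith
  have hrn : r ≤ (k + 1) * n := by
    have : (ℓ : ℝ) ≤ n := by exact_mod_cast (not_le.1 hn).le
    linarith
  -- `y` stands for `σ η`, at the scale that balances `(σ η) ^ (2k)` against `r η`.
  set y : ℝ := (ε * (r / σ)) ^ (1 / (2 * (k : ℝ) - 1)) with hy
  have hρ0 : 0 ≤ ε * (r / σ) := by positivity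
  have hy0 : 0 ≤ y := Real.rpow_nonneg hρ0 _
  have hy1 : y ^ (2 * k - 1) = ε * (r / σ) := by
    rw [hy, ← Real.rpow_natCast, ← Real.rpow_mul hρ0, Nat.cast_sub (by omega)]
    push_cast
    rw [one_div, inv_mul_cancel₀ (by linarith), Real.rpow_one]
  have hy2 : y ^ (2 * k) = ε ^ q * (r / σ) ^ q := by
    rw [hy, ← Real.rpow_natCast, ← Real.rpow_mul hρ0, ← Real.mul_rpow hε0.le (by positivity), hq]
    congr 1
    push_cast
    ring
  have hy3 : y ^ (2 * k) = ε * (r / σ) * y := by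
    rw [← hy1, ← pow_succ]
    congr 1
    omega
  rw [← hy2]
  rcases le_total y 1 with hyle | hyge
  · refine trivial_case _ ?_
    have := pow_le_one₀ hy0 hyle (n := 2 * k)
    have : 0 ≤ ε ^ q * R ^ q := by positivity
    linarith
  -- Equivalent to `ε r ≤ n`, which holds because `r ≤ (k + 1) n`.
  · have hη1 : y / σ ≤ 1 := by
      rw [div_le_one hσ0]
      refine le_of_pow_le_pow_left₀ (n := 2 * k - 1) (by omega) hσ0.le ?_
      rw [hy1, ← mul_div_assoc, div_le_iff₀ hσ0, ← pow_succ,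
        show 2 * k - 1 + 1 = 2 * k by omega, hσn, hε, one_div, ← div_eq_inv_mul,
        div_le_iff₀ (by positivity)]
      nlinarith
    obtain ⟨P, hPd, hP⟩ := (hF n m σ (y / σ) r hσ0 hσn hrm).2 (by positivity) hη1
    refine ⟨P, hPd, fun v hv => (hP v hv).trans ?_⟩
    rw [mul_div_cancel₀ _ hσ0.ne']
    have e1 : K / σ ^ (2 * ℓ) / y ≤ K' / σ ^ (2 * ℓ) :=
      (div_le_self (by positivity) hyge).trans (by gcongr)
    have e2 : r * (y / σ) = (A + 1 + k) * y ^ (2 * k) := by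
      rw [hy3, hε]
      field_simp
    rw [e2]
    gcongr
    nlinarith [pow_nonneg hy0 (2 * k)]

/-- For `ℓ = 0`, subtracting a suitable constant improves on the trivial bound. -/
lemma exists_const_approx_laplacianPoly (hb : 0 < b) (hb2 : b ^ k < 2) :
    ∃ q : ℝ, 0 < q ∧ q < 1 ∧ ∀ n : ℕ, 1 ≤ n → ∃ P : ℂ[X], P.natDegree = 0 ∧
      ∀ v ∈ Set.Icc (-1 : ℝ) 1, ‖(laplacianPoly b k 0 n).eval (v : ℂ)‖ ≤ 1 ∧
        ‖(laplacianPoly b k 0 n).eval (v : ℂ) - P.eval (v : ℂ)‖ ≤ q := by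
  set δ := max 0 (b ^ k - 1) with hδ
  have hδ0 : 0 ≤ δ := le_max_left _ _
  have hδ1 : δ < 1 := max_lt one_pos (by linarith)
  refine ⟨(1 + δ) / 2, by linarith, by linarith, fun n hn => ?_⟩
  -- The midpoint of `[-δ, 1]`, an interval that contains every value `w ^ n`; its half-length is
  -- `q`.
  refine ⟨C (((1 - δ) / 2 : ℝ) : ℂ), natDegree_C _, fun v hv => ?_⟩
  set w : ℝ := 1 - (b / 2 * (1 - v)) ^ k with hw
  have hw1 : w ≤ 1 := by
    have : 0 ≤ b / 2 * (1 - v) := by nlinarith [hv.2]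
    linarith [pow_nonneg this k]
  have hwl : -δ ≤ w := by
    have h0 : 0 ≤ b / 2 * (1 - v) := by nlinarith [hv.2]
    have h1 : b / 2 * (1 - v) ≤ b := by nlinarith [hv.1]
    have := pow_le_pow_left₀ h0 h1 k
    linarith [le_max_right 0 (b ^ k - 1)]
  have hwn1 : w ^ n ≤ 1 := by
    have : |w| ≤ 1 := abs_le.2 ⟨by linarith, hw1⟩
    exact (le_abs_self _).trans (by rw [abs_pow]; exact pow_le_one₀ (abs_nonneg _) this)
  have hwn2 : -δ ≤ w ^ n := by
    rcases le_total 0 w with h | h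
    · linarith [pow_nonneg h n]
    · have h1 : |w| ≤ δ := abs_le.2 ⟨hwl, by linarith⟩
      have h2 : |w ^ n| ≤ δ := by
        rw [abs_pow]
        exact (pow_le_of_le_one (abs_nonneg _) (h1.trans hδ1.le) (by omega)).trans h1
      exact (abs_le.1 h2).1
  rw [eval_laplacianPoly, eval_C]
  have : ((b / 2 : ℂ) * (1 - v)) ^ 0 * (1 - ((b / 2 : ℂ) * (1 - v)) ^ k) ^ n = (w ^ n : ℝ) := by
    rw [hw]; push_cast; ring
  rw [this, ← Complex.ofReal_sub, Complex.norm_real, Complex.norm_real, Real.norm_eq_abs,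
    Real.norm_eq_abs, abs_le, abs_le]
  refine ⟨⟨?_, ?_⟩, ?_, ?_⟩ <;> linarith

/-- Interpolation between exponential decay with a constant and a bound `q < 1`. -/
lemma exists_min_le_exp {K q c : ℝ} (hq0 : 0 < q) (hq1 : q < 1) (hc : 0 < c) :
    ∃ c' : ℝ, 0 < c' ∧ c' ≤ c ∧ ∀ z : ℝ, 0 ≤ z →
      q ≤ Real.exp (-c' * z) ∨ K * Real.exp (-c * z) ≤ Real.exp (-c' * z) := by
  set L := -Real.log q with hL
  have hL0 : 0 < L := neg_pos.2 (Real.log_neg hq0 hq1)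
  set K₁ := max K 1 with hK₁
  have hK10 : 0 < K₁ := lt_max_of_lt_right one_pos
  set a := Real.log K₁ with ha
  have ha0 : 0 ≤ a := Real.log_nonneg (le_max_right _ _)
  have hLa : 0 < L + a := by linarith
  -- The curve `K₁ exp (-c z)` meets the level `q` at `z = (L + a) / c`; this rate makes `exp (-c'
  -- z)` pass through the same point.
  refine ⟨c * L / (L + a), by positivity, ?_, fun z hz => ?_⟩
  · rw [div_le_iff₀ hLa]; nlinarith
  by_cases h : c * z ≤ L + a
  · left
    rw [← Real.exp_log hq0, Real.exp_le_exp, neg_mul, le_neg, ← hL, div_mul_eq_mul_div,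
      div_le_iff₀ hLa]
    nlinarith
  · right
    calc K * Real.exp (-c * z) ≤ K₁ * Real.exp (-c * z) := by gcongr; exact le_max_left _ _
      _ = Real.exp (a - c * z) := by
        rw [← Real.exp_log hK10, ← Real.exp_add]; congr 1; rw [← ha]; ring
      _ ≤ _ := by
        rw [Real.exp_le_exp]
        have e : c * L / (L + a) = c - c * a / (L + a) := by field_simp; ring
        have : a ≤ c * a / (L + a) * z := by
          rw [div_mul_eq_mul_div, le_div_iff₀ hLa]
          nlinarith
        rw [e]
        linarith

/-- Polynomial approximation with sub-Gaussian rate; the constant is `1` for `ℓ = 0`. -/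
lemma exists_approx_laplacianPoly_pow (hk : 1 ≤ k) (hb : 0 < b) (hb2 : b ^ k < 2) :
    ∃ c : ℝ, 0 < c ∧ ∀ ℓ : ℕ, ∃ K : ℝ, 0 < K ∧ ∀ (n m : ℕ) (r : ℝ), 1 ≤ n →
      0 ≤ r → r ≤ m + 1 →
      (∀ v ∈ Set.Icc (-1 : ℝ) 1, ‖(laplacianPoly b k ℓ n).eval (v : ℂ)‖ ≤
        K ^ ℓ * (1 + (n : ℝ)) ^ (-(ℓ : ℝ) / (k : ℝ))) ∧
      ∃ P : ℂ[X], P.natDegree ≤ m ∧ ∀ v ∈ Set.Icc (-1 : ℝ) 1,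
        ‖(laplacianPoly b k ℓ n).eval (v : ℂ) - P.eval (v : ℂ)‖ ≤
          K ^ ℓ * (1 + (n : ℝ)) ^ (-(ℓ : ℝ) / (k : ℝ)) * Real.exp (-c *
            (r / (n : ℝ) ^ (1 / (2 * (k : ℝ)))) ^ (2 * (k : ℝ) / (2 * (k : ℝ) - 1))) := by
  obtain ⟨c, hc, h⟩ := exists_approx_laplacianPoly hk hb hb2
  obtain ⟨q, hq0, hq1, hconst⟩ := exists_const_approx_laplacianPoly hb hb2
  obtain ⟨K₀, hK₀, hF₀⟩ := h 0
  obtain ⟨c', hc', hcc, hmin⟩ := exists_min_le_exp (K := K₀) hq0 hq1 hc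
  have hk0 : (0 : ℝ) < k := by exact_mod_cast hk
  have hσ1 : ∀ n : ℕ, 1 ≤ n → 1 ≤ (n : ℝ) ^ (1 / (2 * (k : ℝ))) := fun n hn =>
    Real.one_le_rpow (by exact_mod_cast hn) (by positivity)
  have hσn : ∀ n : ℕ, ((n : ℝ) ^ (1 / (2 * (k : ℝ)))) ^ (2 * k) = n := fun n => by
    rw [← Real.rpow_natCast, ← Real.rpow_mul (by positivity)]
    push_cast
    rw [one_div, inv_mul_cancel₀ (by positivity), Real.rpow_one]
  refine ⟨c', hc', fun ℓ => ?_⟩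
  rcases Nat.eq_zero_or_pos ℓ with rfl | hℓ
  · refine ⟨1, one_pos, fun n m r hn hr0 hrm => ?_⟩
    set z := (r / (n : ℝ) ^ (1 / (2 * (k : ℝ)))) ^ (2 * (k : ℝ) / (2 * (k : ℝ) - 1)) with hz
    have hz0 : 0 ≤ z := by positivity
    simp only [pow_zero, Nat.cast_zero, neg_zero, zero_div, Real.rpow_zero, one_mul]
    obtain ⟨P, hPd, hP⟩ := hconst n hn
    refine ⟨fun v hv => (hP v hv).1, ?_⟩
    rcases hmin z hz0 with h1 | h1
    · exact ⟨P, by omega, fun v hv => (hP v hv).2.trans h1⟩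
    · obtain ⟨-, P, hPd, hP⟩ := hF₀ n m _ r (hσ1 n hn) (hσn n) hr0 hrm
      refine ⟨P, hPd, fun v hv => (hP v hv).trans (le_trans ?_ h1)⟩
      simp [hz]
  · obtain ⟨K, hK, hF⟩ := h ℓ
    -- The power of `2` replaces `n` by `1 + n`; the maximum with `1` gives `K' ≤ K' ^ ℓ`, as `ℓ ≥
    -- 1`.
    set K' := max 1 (K * 2 ^ ((ℓ : ℝ) / k)) with hK'
    have hK'1 : 1 ≤ K' := le_max_left _ _
    refine ⟨K', by linarith, fun n m r hn hr0 hrm => ?_⟩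
    obtain ⟨hsup, P, hPd, hP⟩ := hF n m _ r (hσ1 n hn) (hσn n) hr0 hrm
    have hn1 : (1 : ℝ) ≤ n := by exact_mod_cast hn
    have e1 : ((n : ℝ) ^ (1 / (2 * (k : ℝ)))) ^ (2 * ℓ) = (n : ℝ) ^ ((ℓ : ℝ) / k) := by
      rw [← Real.rpow_natCast, ← Real.rpow_mul (by positivity)]
      congr 1
      push_cast
      field_simp
    have e2 : K / (n : ℝ) ^ ((ℓ : ℝ) / k) ≤ K' ^ ℓ * (1 + (n : ℝ)) ^ (-(ℓ : ℝ) / (k : ℝ)) := by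
      rw [neg_div, Real.rpow_neg (by positivity), ← div_eq_mul_inv,
        div_le_div_iff₀ (by positivity) (by positivity)]
      calc K * (1 + (n : ℝ)) ^ ((ℓ : ℝ) / k) ≤ K * (2 * n) ^ ((ℓ : ℝ) / k) := by
            gcongr; linarith
        _ = K * 2 ^ ((ℓ : ℝ) / k) * n ^ ((ℓ : ℝ) / k) := by
            rw [Real.mul_rpow (by norm_num) (by positivity)]; ring
        _ ≤ _ := by
            gcongr
            exact (le_max_right _ _).trans (le_self_pow₀ hK'1 (by omega))
    rw [e1] at hP hsup
    exact ⟨fun v hv => (hsup v hv).trans e2, P, hPd, fun v hv => (hP v hv).trans (by gcongr)⟩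

end PolynomialApproximation

/-! ### Transfer to operators and conclusion. -/

section MainTheorem

open Polynomial

/-- The affine map from `[1 - b, 1]` onto `[-1, 1]`, as a polynomial. -/
noncomputable def affinePoly (b : ℝ) : ℂ[X] := 1 - C (2 / b : ℂ) * (1 - X)

lemma aeval_laplacianPoly_comp {A : Type*} [Ring A] [Algebra ℂ A] {b : ℝ} (hb : b ≠ 0)
    (k ℓ n : ℕ) (M : A) :
    aeval M ((laplacianPoly b k ℓ n).comp (affinePoly b)) =
      (1 - M) ^ ℓ * (1 - (1 - M) ^ k) ^ n := by
  have hb' : (b : ℂ) ≠ 0 := by exact_mod_cast hb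
  have h : C (b / 2 : ℂ) * (1 - (1 - C (2 / b : ℂ) * (1 - X))) = 1 - X := by
    rw [sub_sub_cancel, ← mul_assoc, ← C_mul]
    have : (b / 2 : ℂ) * (2 / b) = 1 := by field_simp
    rw [this, C_1, one_mul]
  have h2 : (laplacianPoly b k ℓ n).comp (affinePoly b) =
      (1 - X) ^ ℓ * (1 - (1 - X) ^ k) ^ n := by
    simp only [laplacianPoly, affinePoly, mul_comp, pow_comp, sub_comp, one_comp, C_comp, X_comp, h]
  rw [h2]
  simp

lemma natDegree_affinePoly_le (b : ℝ) : (affinePoly b).natDegree ≤ 1 := by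
  rw [affinePoly]; compute_degree

lemma norm_aeval_comp_affinePoly_le {H : Type*} [NormedAddCommGroup H] [InnerProductSpace ℂ H]
    [CompleteSpace H] {M : H →L[ℂ] H} {a b : ℝ} (hMn : IsStarNormal M)
    (hb : 0 < b) (hab : 1 - a ≤ b)
    (hspec : spectrum ℂ M ⊆ (fun t : ℝ => (t : ℂ)) '' Set.Icc a 1) (Q : ℂ[X]) {B : ℝ}
    (hB : ∀ v ∈ Set.Icc (-1 : ℝ) 1, ‖Q.eval (v : ℂ)‖ ≤ B) :
    ‖aeval M (Q.comp (affinePoly b))‖ ≤ B := by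
  have hB0 : 0 ≤ B := (norm_nonneg _).trans (hB 0 (by simp))
  refine norm_aeval_le_of_isStarNormal hMn _ hB0 fun z hz => ?_
  obtain ⟨t, ht, rfl⟩ := hspec hz
  have e : (affinePoly b).eval (t : ℂ) = ((1 - 2 / b * (1 - t) : ℝ) : ℂ) := by
    simp [affinePoly]
  rw [eval_comp, e]
  refine hB _ ⟨?_, ?_⟩
  · have : 2 / b * (1 - t) ≤ 2 := by
      rw [div_mul_eq_mul_div, div_le_iff₀ hb]
      linarith [ht.1]
    linarith
  · have : 0 ≤ 2 / b * (1 - t) := mul_nonneg (by positivity) (by linarith [ht.2])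
    linarith

/-- Polynomial approximation passes to operators: at large distance, the matrix coefficients agree
with those of an operator whose norm is the error of the approximation. -/
lemma kernel_eq_kernel_aeval_sub {X : Type*} [EMetricSpace X] [MeasurableSpace X]
    [MeasurableSingletonClass X] {π : Measure X}
    (hpos : ∀ x, π {x} ≠ 0) (hfin : ∀ x, π {x} ≠ ∞) {M : Lp ℂ 2 π →L[ℂ] Lp ℂ 2 π} {b : ℝ}
    (hM : ∀ x y, 1 < edist x y → kernel π hfin M x y = 0) {m : ℕ} (F : ℂ[X]) {P : ℂ[X]}
    (hP : P.natDegree ≤ m) {x y : X} (hxy : (m : ℝ≥0∞) < edist x y) :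
    kernel π hfin (aeval M (F.comp (affinePoly b))) y x =
      kernel π hfin (aeval M ((F - P).comp (affinePoly b))) y x := by
  have hPV : (P.comp (affinePoly b)).natDegree ≤ m := by
    rw [natDegree_comp]
    exact (Nat.mul_le_mul hP (natDegree_affinePoly_le b)).trans (by rw [mul_one])
  rw [sub_comp, map_sub, kernel_sub hpos hfin,
    kernel_aeval_eq_zero hpos hfin hM (P.comp _) x y ?_, sub_zero]
  exact lt_of_le_of_lt (by exact_mod_cast hPV) hxy

/-- If the matrix coefficients agree on a set with those of an operator `S`, then their weighted
square sum over that set is bounded by the norm of `S`. -/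
lemma summable_and_sqrt_tsum_le {X : Type*} [MeasurableSpace X]
    [MeasurableSingletonClass X] [Countable X] {π : Measure X} (hfin : ∀ x, π {x} ≠ ∞)
    (T S : Lp ℂ 2 π →L[ℂ] Lp ℂ 2 π) {B : ℝ} (hS : ‖S‖ ≤ B) (x : X) (s : Set X)
    (h : ∀ y ∈ s, kernel π hfin T y x = kernel π hfin S y x) :
    Summable (fun y : s => ‖kernel π hfin T y x‖ ^ 2 * π.real {(y : X)}) ∧
      √(∑' y : s, ‖kernel π hfin T y x‖ ^ 2 * π.real {(y : X)}) ≤ B * √(π.real {x}) := by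
  have hB : 0 ≤ B := (norm_nonneg _).trans hS
  have e : (fun y : s => ‖kernel π hfin T y x‖ ^ 2 * π.real {(y : X)}) =
      fun y : s => ‖kernel π hfin S y x‖ ^ 2 * π.real {(y : X)} := by
    ext y; rw [h y y.2]
  have hsum := hasSum_kernel_sq hfin S x
  rw [e]
  refine ⟨hsum.summable.subtype s, ?_⟩
  rw [Real.sqrt_le_left (by positivity), mul_pow, Real.sq_sqrt measureReal_nonneg]
  refine le_trans ?_ (norm_apply_pointMass_sq_le hfin S x hS)
  rw [← hsum.tsum_eq]
  exact hsum.summable.tsum_subtype_le _ s fun _ => by positivity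

lemma two_mul_pow_lt_two {k : ℕ} (hk : 1 ≤ k) {s : ℝ} (hs : 0 < s)
    (hs' : s < (2 : ℝ) ^ (-1 + 1 / (k : ℝ))) : (2 * s) ^ k < 2 := by
  have hk0 : (0 : ℝ) < k := by exact_mod_cast hk
  rw [Real.rpow_add two_pos, Real.rpow_neg_one] at hs'
  have h : 2 * s < (2 : ℝ) ^ (1 / (k : ℝ)) := by linarith
  have h2 := pow_lt_pow_left₀ h (by positivity) (by omega : k ≠ 0)
  rwa [← Real.rpow_natCast (2 ^ (1 / (k : ℝ))), ← Real.rpow_mul two_pos.le, one_div,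
    inv_mul_cancel₀ hk0.ne', Real.rpow_one] at h2

end MainTheorem

theorem mainTheorem8 (k : ℕ) (hk : 1 ≤ k) (s₀ : ℝ) (hs₀ : 0 < s₀)
    (hs₀' : s₀ < (2 : ℝ) ^ (-1 + 1 / (k : ℝ))) :
    ∃ c : ℝ, 0 < c ∧ ∀ ℓ : ℕ, ∃ C : ℝ, 0 < C ∧
      ∀ (X : Type*) [EMetricSpace X] [Countable X] [MeasurableSpace X]
        [MeasurableSingletonClass X] (π : Measure X) (_hpos : ∀ x, π {x} ≠ 0)
        (hfin : ∀ x, π {x} ≠ ∞) (M : Lp ℂ 2 π →L[ℂ] Lp ℂ 2 π) (a : ℝ),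
        IsStarNormal M → ‖M‖ ≤ 1 →
        (∀ x y, 1 < edist x y → kernel π hfin M x y = 0) →
        -1 ≤ a → a < 1 → 1 - a ≤ 2 * s₀ →
        spectrum ℂ M ⊆ (fun t : ℝ => (t : ℂ)) '' Set.Icc a 1 →
        ∀ n : ℕ, 1 ≤ n →
          (∀ x y : X,
            ‖kernel π hfin ((1 - M) ^ ℓ * powerLaplacianOp M k ^ n) y x‖ ≤
              C ^ ℓ * √(π.real {x} / π.real {y}) * (1 + (n : ℝ)) ^ (-(ℓ : ℝ) / (k : ℝ)) *
                offDiagonalDecay k n c (edist x y)) ∧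
          (∀ (x : X) (r R : ℝ≥0∞),
            Summable (fun y : annulus x r R =>
              ‖kernel π hfin ((1 - M) ^ ℓ * powerLaplacianOp M k ^ n) y x‖ ^ 2 *
                π.real {(y : X)}) ∧
            √(∑' y : annulus x r R,
                ‖kernel π hfin ((1 - M) ^ ℓ * powerLaplacianOp M k ^ n) y x‖ ^ 2 *
                  π.real {(y : X)}) ≤
              C ^ ℓ * √(π.real {x}) * (1 + (n : ℝ)) ^ (-(ℓ : ℝ) / (k : ℝ)) *
                offDiagonalDecay k n c r) := by
  have hb : 0 < 2 * s₀ := by positivity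
  obtain ⟨c, hc, h⟩ := exists_approx_laplacianPoly_pow hk hb (two_mul_pow_lt_two hk hs₀ hs₀')
  refine ⟨c, hc, fun ℓ => ?_⟩
  obtain ⟨K, hK, hF⟩ := h ℓ
  refine ⟨K, hK, ?_⟩
  intro X _ _ _ _ π hpos hfin M a hMn _ hM _ _ hab hspec n hn
  have hk1 : (1 : ℝ) ≤ k := by exact_mod_cast hk
  have hq : 2 * (k : ℝ) / (2 * (k : ℝ) - 1) ≠ 0 :=
    (div_pos (by linarith) (by linarith)).ne'
  set T := (1 - M) ^ ℓ * powerLaplacianOp M k ^ n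
  have hT : T = Polynomial.aeval M ((laplacianPoly (2 * s₀) k ℓ n).comp (affinePoly (2 * s₀))) := by
    rw [aeval_laplacianPoly_comp hb.ne']; rfl
  have approx : ∀ (m : ℕ) (r : ℝ), 0 ≤ r → r ≤ m + 1 →
      ∃ S : Lp ℂ 2 π →L[ℂ] Lp ℂ 2 π,
        ‖S‖ ≤ K ^ ℓ * (1 + (n : ℝ)) ^ (-(ℓ : ℝ) / (k : ℝ)) *
          offDiagonalDecay k n c (ENNReal.ofReal r) ∧
        ∀ x y : X, (m : ℝ≥0∞) < edist x y → kernel π hfin T y x = kernel π hfin S y x := by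
    intro m r hr0 hr
    obtain ⟨-, P, hPd, hP⟩ := hF n m r hn hr0 hr
    refine ⟨_, (norm_aeval_comp_affinePoly_le hMn hb hab hspec (laplacianPoly _ k ℓ n - P)
      fun v hv => by rw [Polynomial.eval_sub]; exact hP v hv).trans_eq ?_, fun x y hxy => ?_⟩
    · rw [offDiagonalDecay, if_neg ENNReal.ofReal_ne_top, ENNReal.toReal_ofReal hr0]
    · rw [hT]
      exact kernel_eq_kernel_aeval_sub hpos hfin hM _ hPd hxy
  have hTn : ‖T‖ ≤ K ^ ℓ * (1 + (n : ℝ)) ^ (-(ℓ : ℝ) / (k : ℝ)) := by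
    rw [hT]
    exact norm_aeval_comp_affinePoly_le hMn hb hab hspec _
      (hF n 0 0 hn le_rfl (by norm_num)).1
  refine ⟨fun x y => ?_, fun x r R => ?_⟩
  · rw [mul_right_comm (K ^ ℓ), mul_right_comm _ (√(π.real {x} / π.real {y}))]
    rcases eq_or_ne (edist x y) ∞ with htop | htop
    · have : kernel π hfin T y x = 0 := by
        rw [hT]
        exact kernel_aeval_eq_zero hpos hfin hM _ x y (htop ▸ ENNReal.natCast_lt_top _)
      simp [this, htop, offDiagonalDecay]
    · rcases eq_or_ne x y with rfl | hxy
      · rw [edist_self, offDiagonalDecay, if_neg ENNReal.zero_ne_top, ENNReal.toReal_zero,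
          zero_div, Real.zero_rpow hq, mul_zero, Real.exp_zero, mul_one]
        exact norm_kernel_le hpos hfin T x x hTn
      · have hd0 : 0 < (edist x y).toReal := ENNReal.toReal_pos (by simpa using hxy) htop
        -- The largest integer strictly below the distance: degree `m` does not reach `y`, while
        -- `d(x, y) ≤ m + 1` preserves the full rate with constant `1`.
        obtain ⟨m, hm⟩ : ∃ m, ⌈(edist x y).toReal⌉₊ = m + 1 :=
          Nat.exists_eq_succ_of_ne_zero (Nat.ceil_pos.2 hd0).ne'
        obtain ⟨S, hS, hTS⟩ := approx m (edist x y).toReal hd0.le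
          (by exact_mod_cast hm ▸ Nat.le_ceil _)
        rw [ENNReal.ofReal_toReal htop] at hS
        rw [hTS x y ?_]
        · exact norm_kernel_le hpos hfin S x y hS
        · rw [← ENNReal.ofReal_toReal htop, ← ENNReal.ofReal_natCast,
            ENNReal.ofReal_lt_ofReal_iff hd0]
          exact Nat.lt_ceil.1 (by omega)
  · rw [mul_right_comm (K ^ ℓ), mul_right_comm _ (√(π.real {x}))]
    rcases eq_or_ne r ∞ with rfl | hr
    · have he : annulus x ∞ R = ∅ := by ext y; simp [annulus]
      have : IsEmpty (annulus x ∞ R) := by rw [he]; infer_instance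
      refine ⟨summable_empty, ?_⟩
      simp [offDiagonalDecay]
    -- In the annulus the distance strictly exceeds `r`, so the floor is admissible, and a single
    -- `S` serves all its points.
    · obtain ⟨S, hS, hTS⟩ := approx ⌊r.toReal⌋₊ r.toReal ENNReal.toReal_nonneg
        (Nat.lt_floor_add_one _).le
      rw [ENNReal.ofReal_toReal hr] at hS
      refine summable_and_sqrt_tsum_le hfin T S hS x _ fun y hy => hTS x y ?_
      refine lt_of_le_of_lt ?_ hy.1
      rw [← ENNReal.ofReal_toReal hr, ← ENNReal.ofReal_natCast]
      exact ENNReal.ofReal_le_ofReal (by simpa using Nat.floor_le ENNReal.toReal_nonneg)
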